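/- Let $n,p\ge 1$. Let $\mathbb{R}^n_\ell$ denote $\mathbb{R}^n$ with the Sorgenfrey topology, whose base consists of the rectangles $\prod_{i=1}^n[a_i,b_i)$ with $a_i<b_i$, and let $C_b(\mathbb{R}^n_\ell)$ be the space of bounded continuous real-valued functions on $\mathbb{R}^n_\ell$; similarly for $p$. Let $\mu$ and $\nu$ be Radon probability measures on $\mathbb{R}^n$ and $\mathbb{R}^p$ (with the usual topologies), and let $c:\mathbb{R}^n_\ell\times\mathbb{R}^p_\ell\to\mathbb{R}$ be a bounded function with property $(H)$: for all $x_0\in\mathbb{R}^n$ and $y_0\in\mathbb{R}^p$, $$\lim_{x\to x_0}\ \sup_{y}|c(x,y)-c(x_0,y)|=0\ \text{ in } \mathbb{R}^n_\ell,\qquad \lim_{y\to y_0}\ \sup_{x}|c(x,y)-c(x,y_0)|=0\ \text{ in } \mathbb{R}^p_\ell .$$ Let $\Pi(\mu,\nu)$ be the set of Radon probability measures on $\mathbb{R}^n\times\mathbb{R}^p$ (with the usual topology) with marginals $\mu$ and $\nu$. For functions $\xi$ on $\mathbb{R}^n$ and $\zeta$ on $\mathbb{R}^p$ put $\xi^c(y)=\inf_x\{c(x,y)-\xi(x)\}$,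 $\zeta^{\bar c}(x)=\inf_y\{c(x,y)-\zeta(y)\}$ and $\xi^{c\bar c}=(\xi^c)^{\bar c}$. Then the function $c$ is integrable with respect to every $\gamma\in\Pi(\mu,\nu)$, the functions in $C_b(\mathbb{R}^n_\ell)$ are $\mu$-integrable, those in $C_b(\mathbb{R}^p_\ell)$ are $\nu$-integrable, and the following hold. 1. The problem (KP) of minimizing $\int c\,d\gamma$ over $\gamma\in\Pi(\mu,\nu)$ has a solution $\gamma^*\in\Pi(\mu,\nu)$. 2. The problem (DP) of maximizing $\int\phi\,d\mu+\int\psi\,d\nu$ over all pairs $(\phi,\psi)\in C_b(\mathbb{R}^n_\ell)\times C_b(\mathbb{R}^p_\ell)$ such that $\phi(x)+\psi(y)\le c(x,y)$ for all $x,y$ has a solution of the form $(\phi^*,\psi^*)=(\xi_0^{c\bar c},\xi_0^{c})\in C_b(\mathbb{R}^n_\ell)\times C_b(\mathbb{R}^p_\ell)$ for some $\xi_0\in C_b(\mathbb{R}^n_\ell)$. 3. The maximal value of (DP) equals the minimal value of (KP). -/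

import Mathlib

open MeasureTheory Topology Filter
open scoped BoundedContinuousFunction

section CostFunctions

variable {X Y : Type*}

/-- `d̄_c(x, x') = sup_{y} |c(x, y) - c(x', y)|` (used for bounded `c` only). -/
noncomputable def dUpper (c : X × Y → ℝ) (x x' : X) : ℝ :=
  ⨆ y : Y, |c (x, y) - c (x', y)|

/-- `d̲_c(y, y') = sup_{x} |c(x, y) - c(x, y')|` (used for bounded `c` only). -/
noncomputable def dLower (c : X × Y → ℝ) (y y' : Y) : ℝ :=
  ⨆ x : X, |c (x, y) - c (x, y')|

/-- Property (H): `d̄_c(x, x₀) → 0` as `x → x₀` and `d̲_c(y, y₀) → 0` as `y → y₀`, for all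
`x₀` and `y₀`. -/
def PropertyH [TopologicalSpace X] [TopologicalSpace Y] (c : X × Y → ℝ) : Prop :=
  (∀ x₀ : X, Tendsto (fun x => dUpper c x x₀) (𝓝 x₀) (𝓝 0)) ∧
    (∀ y₀ : Y, Tendsto (fun y => dLower c y y₀) (𝓝 y₀) (𝓝 0))

/-- The `c`-transform `ξ^c(y) = inf_x (c(x, y) - ξ(x))` (used for bounded `c` and `ξ` only). -/
noncomputable def cTransform (c : X × Y → ℝ) (ξ : X → ℝ) : Y → ℝ :=
  fun y => ⨅ x : X, (c (x, y) - ξ x)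

/-- The `c̄`-transform `ζ^c̄(x) = inf_y (c(x, y) - ζ(y))` (used for bounded `c` and `ζ` only). -/
noncomputable def cBarTransform (c : X × Y → ℝ) (ζ : Y → ℝ) : X → ℝ :=
  fun x => ⨅ y : Y, (c (x, y) - ζ y)

end CostFunctions

/-- The Sorgenfrey space `ℝⁿ_ℓ`: a copy of the set `ℝⁿ`, to be given the Sorgenfrey topology. -/
def SorgenfreySpace (n : ℕ) : Type := Fin n → ℝ

/-- The identity map from `ℝⁿ` to `ℝⁿ_ℓ`. -/
def toSorgenfrey (n : ℕ) : (Fin n → ℝ) ≃ SorgenfreySpace n := Equiv.refl _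

/-- The half-open rectangle `∏ᵢ [aᵢ, bᵢ)` as a subset of `ℝⁿ_ℓ`. -/
def sorgenfreyRectangle {n : ℕ} (a b : Fin n → ℝ) : Set (SorgenfreySpace n) :=
  {x | ∀ i, a i ≤ (toSorgenfrey n).symm x i ∧ (toSorgenfrey n).symm x i < b i}

/-- The topology generated by the rectangles `∏ᵢ [aᵢ, bᵢ)` with `aᵢ < bᵢ`. -/
instance SorgenfreySpace.instTopologicalSpace (n : ℕ) : TopologicalSpace (SorgenfreySpace n) :=
  TopologicalSpace.generateFrom
    {S | ∃ a b : Fin n → ℝ, (∀ i, a i < b i) ∧ S = sorgenfreyRectangle a b}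

section Kantorovich

variable {n p : ℕ}

/-- The set `Π(μ, ν)` of transport plans: the Radon probability measures on `ℝⁿ × ℝᵖ` (with the
usual topology) with marginals `μ` and `ν`. For finite measures, inner regularity of all
Borel sets with respect to compact sets is the Radon property. -/
def transportPlans (μ : Measure (Fin n → ℝ)) (ν : Measure (Fin p → ℝ)) :
    Set (Measure ((Fin n → ℝ) × (Fin p → ℝ))) :=
  {γ | IsProbabilityMeasure γ ∧ γ.InnerRegular ∧
    γ.map Prod.fst = μ ∧ γ.map Prod.snd = ν}

/-- The cost `c`, a function on `ℝⁿ_ℓ × ℝᵖ_ℓ`, read as a function on `ℝⁿ × ℝᵖ`. -/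
def costOnEuclidean (c : SorgenfreySpace n × SorgenfreySpace p → ℝ) :
    (Fin n → ℝ) × (Fin p → ℝ) → ℝ :=
  fun z => c (toSorgenfrey n z.1, toSorgenfrey p z.2)

/-- The objective `∫ c dγ` of (KP). -/
noncomputable def primalObjective (c : SorgenfreySpace n × SorgenfreySpace p → ℝ)
    (γ : Measure ((Fin n → ℝ) × (Fin p → ℝ))) : ℝ :=
  ∫ z, costOnEuclidean c z ∂γ

/-- The value of (KP). -/
noncomputable def primalValue (c : SorgenfreySpace n × SorgenfreySpace p → ℝ)
    (μ : Measure (Fin n → ℝ)) (ν : Measure (Fin p → ℝ)) : ℝ :=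
  sInf (primalObjective c '' transportPlans μ ν)

/-- The admissible pairs of (DP): `(φ, ψ) ∈ C_b(ℝⁿ_ℓ) × C_b(ℝᵖ_ℓ)` with
`φ(x) + ψ(y) ≤ c(x, y)` everywhere. -/
def dualAdmissible (c : SorgenfreySpace n × SorgenfreySpace p → ℝ) :
    Set ((SorgenfreySpace n →ᵇ ℝ) × (SorgenfreySpace p →ᵇ ℝ)) :=
  {q | ∀ x y, q.1 x + q.2 y ≤ c (x, y)}

/-- The objective `∫ φ dμ + ∫ ψ dν` of (DP). -/
noncomputable def dualObjective (μ : Measure (Fin n → ℝ)) (ν : Measure (Fin p → ℝ))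
    (q : (SorgenfreySpace n →ᵇ ℝ) × (SorgenfreySpace p →ᵇ ℝ)) : ℝ :=
  (∫ x, q.1 (toSorgenfrey n x) ∂μ) + ∫ y, q.2 (toSorgenfrey p y) ∂ν

/-- The value of (DP). -/
noncomputable def dualValue (c : SorgenfreySpace n × SorgenfreySpace p → ℝ)
    (μ : Measure (Fin n → ℝ)) (ν : Measure (Fin p → ℝ)) : ℝ :=
  sSup (dualObjective μ ν '' dualAdmissible c)

end Kantorovich

/-! ### Pseudo-distances attached to a bounded cost, and bounds for transforms. -/

section CostBounds

variable {X Y : Type*} {c : X × Y → ℝ} {M : ℝ}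

/-! The Sorgenfrey topology need not be Polish, but the cost sees it only through the
pseudo-distances `dUpper c` and `dLower c`. By (H) these are Sorgenfrey-continuous, hence Borel, and
countably many grid corners are dense for them. The usual topology of each factor can therefore be
refined to a Polish one, with the same Borel sets, in which the pseudo-distance is continuous
(`exists_polish_of_sorgenfrey`). For the refined topologies `c` is jointly continuous, while the
transport plans are the same measures as before.

The classical theory then applies: tightness gives an optimal plan (`exists_optimal_plan`), its
support is cyclically monotone (`isCyclicallyMonotone_support`), and Rockafellar's chain
construction yields a potential `ξ` (`IsCyclicallyMonotone.exists_potential`). This potential is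
1-Lipschitz for `dUpper c`, so it is continuous for the Sorgenfrey topology itself and not just for
the auxiliary one.

Almost everywhere for the optimal plan, `ξ(x) + ξ^c(y) = c(x, y)`. Replacing `ξ` by the larger `ξ^{c
c̄}` keeps admissibility, hence equality; integrating and comparing with weak duality proves
optimality of both sides at once. -/

lemma abs_sub_le_dUpper (hM : ∀ z, |c z| ≤ M) (x x' : X) (y : Y) :
    |c (x, y) - c (x', y)| ≤ dUpper c x x' := by
  refine le_ciSup (f := fun y => |c (x, y) - c (x', y)|) ⟨2 * M, ?_⟩ y
  rintro _ ⟨y, rfl⟩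
  have h₁ := hM (x, y)
  have h₂ := hM (x', y)
  have h₃ := abs_sub (c (x, y)) (c (x', y))
  dsimp only
  linarith

lemma abs_sub_le_dLower (hM : ∀ z, |c z| ≤ M) (x : X) (y y' : Y) :
    |c (x, y) - c (x, y')| ≤ dLower c y y' :=
  abs_sub_le_dUpper (c := c ∘ Prod.swap) (fun _ => hM _) y y' x

lemma dUpper_nonneg (c : X × Y → ℝ) (x x' : X) : 0 ≤ dUpper c x x' :=
  Real.iSup_nonneg fun _ => abs_nonneg _

lemma dUpper_le (hM : ∀ z, |c z| ≤ M) (hM₀ : 0 ≤ M) (x x' : X) : dUpper c x x' ≤ 2 * M := by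
  refine Real.iSup_le (fun y => ?_) (by linarith)
  have h₁ := hM (x, y)
  have h₂ := hM (x', y)
  have h₃ := abs_sub (c (x, y)) (c (x', y))
  linarith

lemma dUpper_comm (c : X × Y → ℝ) (x x' : X) : dUpper c x x' = dUpper c x' x := by
  simp only [dUpper, abs_sub_comm]

lemma dUpper_triangle (hM : ∀ z, |c z| ≤ M) (x y z : X) :
    dUpper c x z ≤ dUpper c x y + dUpper c y z := by
  -- `Y` may be empty, where the supremum is 0 by convention; hence the nonnegativity side goal.
  refine Real.iSup_le (fun w => ?_) (add_nonneg (dUpper_nonneg _ _ _) (dUpper_nonneg _ _ _))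
  have h₁ := abs_sub_le_dUpper hM x y w
  have h₂ := abs_sub_le_dUpper hM y z w
  have h₃ := abs_sub_le (c (x, w)) (c (y, w)) (c (z, w))
  linarith

lemma bddBelow_range_cost_sub (hM : ∀ z, |c z| ≤ M) {ξ : X → ℝ} {B : ℝ} (hB : ∀ x, |ξ x| ≤ B)
    (y : Y) : BddBelow (Set.range fun x => c (x, y) - ξ x) := by
  refine ⟨-M - B, ?_⟩
  rintro _ ⟨x, rfl⟩
  have h₁ := abs_le.1 (hM (x, y))
  have h₂ := abs_le.1 (hB x)
  dsimp only
  linarith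

lemma add_cTransform_le (hM : ∀ z, |c z| ≤ M) {ξ : X → ℝ} {B : ℝ} (hB : ∀ x, |ξ x| ≤ B)
    (x : X) (y : Y) : ξ x + cTransform c ξ y ≤ c (x, y) := by
  have : cTransform c ξ y ≤ c (x, y) - ξ x := ciInf_le (bddBelow_range_cost_sub hM hB y) x
  linarith

lemma abs_cTransform_le [Nonempty X] (hM : ∀ z, |c z| ≤ M) {ξ : X → ℝ} {B : ℝ}
    (hB : ∀ x, |ξ x| ≤ B) (y : Y) : |cTransform c ξ y| ≤ M + B := by
  obtain ⟨x⟩ := ‹Nonempty X›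
  have : Nonempty X := ⟨x⟩
  refine abs_le.2 ⟨le_ciInf fun x => ?_, ?_⟩
  · have h₁ := abs_le.1 (hM (x, y))
    have h₂ := abs_le.1 (hB x)
    linarith
  · have h := add_cTransform_le hM hB x y
    have h₁ := abs_le.1 (hM (x, y))
    have h₂ := abs_le.1 (hB x)
    linarith

/-- An infimum of functions of `y`, each 1-Lipschitz for `dLower c`, is again 1-Lipschitz; with (H)
this makes transforms Sorgenfrey-continuous. -/
lemma cTransform_sub_le [Nonempty X] (hM : ∀ z, |c z| ≤ M) {ξ : X → ℝ} {B : ℝ}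
    (hB : ∀ x, |ξ x| ≤ B) (y y' : Y) :
    cTransform c ξ y - cTransform c ξ y' ≤ dLower c y y' := by
  have : cTransform c ξ y - dLower c y y' ≤ cTransform c ξ y' := by
    refine le_ciInf fun x => ?_
    have h := add_cTransform_le hM hB x y
    have h₁ := (abs_le.1 (abs_sub_le_dLower hM x y y')).2
    linarith
  linarith

end CostBounds

/-! ### Cyclical monotonicity and Rockafellar's potential. -/

section CyclicalMonotonicity

variable {X Y : Type*}

/-- A set of pairs is `c`-cyclically monotone if no finite rearrangement of its points lowers the
total cost. -/
def IsCyclicallyMonotone (c : X × Y → ℝ) (Γ : Set (X × Y)) : Prop :=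
  ∀ (N : ℕ) (z : Fin N → X × Y) (σ : Equiv.Perm (Fin N)), (∀ i, z i ∈ Γ) →
    ∑ i, c (z i) ≤ ∑ i, c ((z (σ i)).1, (z i).2)

/-- The cost of joining `x` to `s 0` along the chain `s 0, …, s k`. -/
def chainCost (c : X × Y → ℝ) (s : ℕ → X × Y) (k : ℕ) (x : X) : ℝ :=
  c (x, (s k).2) - c (s k) + ∑ i ∈ Finset.range k, (c ((s (i + 1)).1, (s i).2) - c (s i))

/-- A chain that returns to its starting abscissa is a cyclic rearrangement of its points, given by
`finRotate`. -/
lemma IsCyclicallyMonotone.chainCost_nonneg {c : X × Y → ℝ} {Γ : Set (X × Y)}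
    (h : IsCyclicallyMonotone c Γ) {s : ℕ → X × Y} (hs : ∀ i, s i ∈ Γ) (k : ℕ) :
    0 ≤ chainCost c s k (s 0).1 := by
  have key := h (k + 1) (fun i => s i) (finRotate (k + 1)) fun i => hs i
  rw [Fin.sum_univ_castSucc, Fin.sum_univ_castSucc] at key
  simp only [Fin.val_castSucc, Fin.val_last, finRotate_last, Fin.val_zero] at key
  have h₁ : ∀ i : Fin k, ((finRotate (k + 1) i.castSucc : Fin (k + 1)) : ℕ) = i + 1 := fun i => by
    rw [coe_finRotate_of_ne_last (Fin.castSucc_lt_last i).ne, Fin.val_castSucc]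
  simp only [h₁] at key
  rw [chainCost, Finset.sum_sub_distrib, Finset.sum_range, Finset.sum_range]
  linarith

lemma chainCost_sub_le {c : X × Y → ℝ} {M : ℝ} (hM : ∀ z, |c z| ≤ M) (s : ℕ → X × Y) (k : ℕ)
    (x x' : X) : chainCost c s k x - chainCost c s k x' ≤ dUpper c x x' := by
  have h := (abs_le.1 (abs_sub_le_dUpper hM x x' (s k).2)).2
  simp only [chainCost]
  linarith

lemma chainCost_update (c : X × Y → ℝ) (s : ℕ → X × Y) (k : ℕ) (z : X × Y) (x : X) :
    chainCost c (Function.update s (k + 1) z) (k + 1) x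
      = c (x, z.2) - c z + chainCost c s k z.1 := by
  have h : ∀ i ∈ Finset.range k, Function.update s (k + 1) z i = s i ∧
      Function.update s (k + 1) z (i + 1) = s (i + 1) := fun i hi => by
    have := Finset.mem_range.1 hi
    exact ⟨Function.update_of_ne (by omega) _ _, Function.update_of_ne (by omega) _ _⟩
  have hsum : ∑ i ∈ Finset.range k, (c ((Function.update s (k + 1) z (i + 1)).1,
      (Function.update s (k + 1) z i).2) - c (Function.update s (k + 1) z i))
      = ∑ i ∈ Finset.range k, (c ((s (i + 1)).1, (s i).2) - c (s i)) :=
    Finset.sum_congr rfl fun i hi => by rw [(h i hi).1, (h i hi).2]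
  have hk : Function.update s (k + 1) z k = s k := Function.update_of_ne (by omega) _ _
  simp only [chainCost, Finset.sum_range_succ, hsum, Function.update_self, hk]
  ring

/-- Rockafellar's construction: a cyclically monotone set carries a bounded potential that is
Lipschitz for `dUpper c`. -/
theorem IsCyclicallyMonotone.exists_potential {c : X × Y → ℝ} {M : ℝ} (hM : ∀ z, |c z| ≤ M)
    {Γ : Set (X × Y)} (hΓ : Γ.Nonempty) (h : IsCyclicallyMonotone c Γ) :
    ∃ φ : X → ℝ, (∀ x x', φ x - φ x' ≤ dUpper c x x') ∧ (∃ B, ∀ x, |φ x| ≤ B) ∧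
      ∀ z ∈ Γ, ∀ x, φ x - φ z.1 ≤ c (x, z.2) - c z := by
  obtain ⟨z₀, hz₀⟩ := hΓ
  -- The potential is the infimum of the chain cost over all chains in `Γ` that start at the fixed
  -- point `z₀`.
  let I := {t : (ℕ → X × Y) × ℕ // t.1 0 = z₀ ∧ ∀ i, t.1 i ∈ Γ}
  have : Nonempty I := ⟨⟨(fun _ => z₀, 0), rfl, fun _ => hz₀⟩⟩
  have hbdd : ∀ x, BddBelow (Set.range fun t : I => chainCost c t.1.1 t.1.2 x) := fun x => by
    refine ⟨-dUpper c z₀.1 x, ?_⟩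
    rintro _ ⟨⟨⟨s, k⟩, hs₀, hs⟩, rfl⟩
    have h₁ := h.chainCost_nonneg hs k
    have h₂ := chainCost_sub_le hM s k z₀.1 x
    rw [hs₀] at h₁
    dsimp only
    linarith
  have hLip : ∀ x x', (⨅ t : I, chainCost c t.1.1 t.1.2 x) - (⨅ t : I, chainCost c t.1.1 t.1.2 x')
      ≤ dUpper c x x' := fun x x' => by
    have : (⨅ t : I, chainCost c t.1.1 t.1.2 x) - dUpper c x x'
        ≤ ⨅ t : I, chainCost c t.1.1 t.1.2 x' := by
      refine le_ciInf fun t => ?_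
      have h₁ := ciInf_le (hbdd x) t
      have h₂ := chainCost_sub_le hM t.1.1 t.1.2 x x'
      linarith
    linarith
  have hM₀ : 0 ≤ M := (abs_nonneg _).trans (hM z₀)
  refine ⟨fun x => ⨅ t : I, chainCost c t.1.1 t.1.2 x, hLip,
    ⟨|⨅ t : I, chainCost c t.1.1 t.1.2 z₀.1| + 2 * M, fun x => ?_⟩, fun z hz x => ?_⟩
  · have h₁ := hLip x z₀.1
    have h₂ := hLip z₀.1 x
    have h₃ := dUpper_le hM hM₀ x z₀.1
    have h₄ := dUpper_le hM hM₀ z₀.1 x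
    have h₅ := le_abs_self (⨅ t : I, chainCost c t.1.1 t.1.2 z₀.1)
    have h₆ := neg_abs_le (⨅ t : I, chainCost c t.1.1 t.1.2 z₀.1)
    exact abs_le.2 ⟨by linarith, by linarith⟩
  · have : (⨅ t : I, chainCost c t.1.1 t.1.2 x) - (c (x, z.2) - c z)
        ≤ ⨅ t : I, chainCost c t.1.1 t.1.2 z.1 := by
      refine le_ciInf fun ⟨⟨s, k⟩, hs₀, hs⟩ => ?_
      have hs' : ∀ i, Function.update s (k + 1) z i ∈ Γ := fun i => by
        by_cases hi : i = k + 1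
        · rw [hi, Function.update_self]
          exact hz
        · rw [Function.update_of_ne hi]
          exact hs i
      have h₀ : Function.update s (k + 1) z 0 = z₀ :=
        (Function.update_of_ne (Nat.succ_ne_zero k).symm _ _).trans hs₀
      -- Appending `z` to a chain gives a competitor for the infimum at `x`.
      have h₁ := ciInf_le (hbdd x) ⟨(Function.update s (k + 1) z, k + 1),
        h₀, hs'⟩
      dsimp only at h₁ ⊢
      rw [chainCost_update] at h₁
      linarith
    dsimp only
    linarith

end CyclicalMonotonicity

/-! ### Kantorovich's problem for continuous costs on Polish spaces. -/

section OptimalPlans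

open scoped ENNReal ProbabilityTheory

variable {X Y : Type*}

lemma abs_integral_sub_le_of_ae {Ω : Type*} [MeasurableSpace Ω] {P : Measure Ω}
    [IsProbabilityMeasure P] {f : Ω → ℝ} (hf : Integrable f P) {a ε : ℝ}
    (h : ∀ᵐ ω ∂P, |f ω - a| ≤ ε) : |∫ ω, f ω ∂P - a| ≤ ε := by
  have h₁ : ∫ ω, f ω ∂P - a = ∫ ω, (f ω - a) ∂P := by
    rw [integral_sub hf (integrable_const a)]
    simp
  have h₂ := norm_integral_le_of_norm_le_const (μ := P) (f := fun ω => f ω - a) h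
  rw [h₁]
  simpa using h₂

/-- Finitely many sets of positive measure carry a common multiple of their conditional measures
that is dominated by the original measure. -/
lemma exists_sum_smul_cond_le {Ω : Type*} [MeasurableSpace Ω] (P : Measure Ω)
    [IsProbabilityMeasure P] {N : ℕ} (hN : 0 < N) {W : Fin N → Set Ω}
    (hW : ∀ i, MeasurableSet (W i)) (hpos : ∀ i, P (W i) ≠ 0) :
    ∃ s : ℝ≥0∞, s ≠ 0 ∧ s ≠ ∞ ∧ ∑ i, s • P[|W i] ≤ P := by
  have : Nonempty (Fin N) := ⟨⟨0, hN⟩⟩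
  obtain ⟨i₀, hi₀⟩ := Finite.exists_min fun i => P (W i)
  have hN' : (N : ℝ≥0∞) ≠ 0 := by exact_mod_cast hN.ne'
  -- The smallest mass bounds each conditional measure's multiple by `P`; the factor `1 / N` pays
  -- for overlaps of the `W i`.
  refine ⟨(N : ℝ≥0∞)⁻¹ * P (W i₀), mul_ne_zero (by simp) (hpos i₀),
    ENNReal.mul_ne_top (ENNReal.inv_ne_top.2 hN') (measure_ne_top _ _), ?_⟩
  refine Measure.le_iff.2 fun A hA => ?_
  have hle : ∀ i, (((N : ℝ≥0∞)⁻¹ * P (W i₀)) • P[|W i]) A ≤ (N : ℝ≥0∞)⁻¹ * P A := fun i => by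
    rw [Measure.smul_apply, smul_eq_mul, ProbabilityTheory.cond_apply (hW i), mul_assoc]
    gcongr
    calc P (W i₀) * ((P (W i))⁻¹ * P (W i ∩ A))
        ≤ P (W i) * ((P (W i))⁻¹ * P A) := by
          refine mul_le_mul' (hi₀ i) ?_
          gcongr
          exact Set.inter_subset_right
      _ = P A := by
          rw [← mul_assoc, ENNReal.mul_inv_cancel (hpos i) (measure_ne_top _ _), one_mul]
  rw [Measure.finsetSum_apply]
  calc ∑ i, (((N : ℝ≥0∞)⁻¹ * P (W i₀)) • P[|W i]) A
      ≤ ∑ _i : Fin N, (N : ℝ≥0∞)⁻¹ * P A := Finset.sum_le_sum fun i _ => hle i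
    _ = P A := by
        rw [Finset.sum_const, Finset.card_univ, Fintype.card_fin, nsmul_eq_mul, ← mul_assoc,
          ENNReal.mul_inv_cancel hN' (by simp), one_mul]

lemma map_sum_smul {Ω Z ι : Type*} [Fintype ι] [MeasurableSpace Ω] [MeasurableSpace Z] {f : Ω → Z}
    (hf : Measurable f) (s : ℝ≥0∞) (P : ι → Measure Ω) :
    (∑ i, s • P i).map f = ∑ i, s • (P i).map f := by
  simp only [← Measure.mapₗ_apply_of_measurable hf, map_sum, map_smul]

lemma ae_mem_fst_prod_snd [MeasurableSpace X] [MeasurableSpace Y] {η η' : Measure (X × Y)}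
    [IsProbabilityMeasure η] [IsProbabilityMeasure η'] {U : Set X} {V : Set Y}
    (hU : MeasurableSet U) (hV : MeasurableSet V) (h : ∀ᵐ z ∂η, z.1 ∈ U)
    (h' : ∀ᵐ z ∂η', z.2 ∈ V) :
    ∀ᵐ z ∂((η.map Prod.fst).prod (η'.map Prod.snd)), z.1 ∈ U ∧ z.2 ∈ V := by
  have : IsProbabilityMeasure (η.map Prod.fst) :=
    Measure.isProbabilityMeasure_map measurable_fst.aemeasurable
  have : IsProbabilityMeasure (η'.map Prod.snd) :=
    Measure.isProbabilityMeasure_map measurable_snd.aemeasurable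
  refine Filter.Eventually.and ?_ ?_
  · exact Measure.quasiMeasurePreserving_fst.ae
      ((ae_map_iff measurable_fst.aemeasurable hU).2 h)
  · exact Measure.quasiMeasurePreserving_snd.ae
      ((ae_map_iff measurable_snd.aemeasurable hV).2 h')

variable [TopologicalSpace X] [TopologicalSpace Y] [PolishSpace X] [PolishSpace Y]

/-- Near finitely many points a continuous function is nearly constant on rectangles with sides
from a single family. -/
lemma exists_open_rectangles {c : X × Y → ℝ} (hc : Continuous c) {N : ℕ} (z : Fin N → X × Y)
    {ε : ℝ} (hε : 0 < ε) :
    ∃ (U : Fin N → Set X) (V : Fin N → Set Y), (∀ i, IsOpen (U i) ∧ (z i).1 ∈ U i) ∧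
      (∀ i, IsOpen (V i) ∧ (z i).2 ∈ V i) ∧
      ∀ i j, ∀ x ∈ U i, ∀ y ∈ V j, |c (x, y) - c ((z i).1, (z j).2)| ≤ ε := by
  let := TopologicalSpace.upgradeIsCompletelyMetrizable X
  let := TopologicalSpace.upgradeIsCompletelyMetrizable Y
  have h : ∀ i j, ∀ᶠ δ in 𝓝[>] (0 : ℝ), ∀ x ∈ Metric.ball (z i).1 δ, ∀ y ∈ Metric.ball (z j).2 δ,
      |c (x, y) - c ((z i).1, (z j).2)| ≤ ε := fun i j => by
    obtain ⟨r, hr, hr'⟩ := Metric.continuousAt_iff.1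
      (hc.continuousAt (x := ((z i).1, (z j).2))) ε hε
    filter_upwards [Ioo_mem_nhdsGT hr] with δ hδ x hx y hy
    have : dist (x, y) ((z i).1, (z j).2) < r :=
      max_lt (lt_trans (Metric.mem_ball.1 hx) hδ.2) (lt_trans (Metric.mem_ball.1 hy) hδ.2)
    exact (hr' this).le
  obtain ⟨δ, hδ, hδ₀⟩ := ((eventually_all.2 fun i => eventually_all.2 fun j => h i j).and
    self_mem_nhdsWithin).exists
  exact ⟨fun i => Metric.ball (z i).1 δ, fun i => Metric.ball (z i).2 δ,
    fun i => ⟨Metric.isOpen_ball, Metric.mem_ball_self hδ₀⟩,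
    fun i => ⟨Metric.isOpen_ball, Metric.mem_ball_self hδ₀⟩, hδ⟩

variable [MeasurableSpace X] [MeasurableSpace Y] [BorelSpace X] [BorelSpace Y]

/-- The support of an optimal plan for a bounded continuous cost is cyclically monotone. -/
theorem isCyclicallyMonotone_support {c : X × Y → ℝ} (hc : Continuous c) {M : ℝ}
    (hM : ∀ z, |c z| ≤ M) (γ : Measure (X × Y)) [IsProbabilityMeasure γ]
    (hopt : ∀ γ' : Measure (X × Y), IsProbabilityMeasure γ' →
      γ'.map Prod.fst = γ.map Prod.fst → γ'.map Prod.snd = γ.map Prod.snd →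
      ∫ z, c z ∂γ ≤ ∫ z, c z ∂γ') :
    IsCyclicallyMonotone c γ.support := by
  intro N z σ hz
  by_contra! hlt
  have hint : ∀ P : Measure (X × Y), IsFiniteMeasure P → Integrable c P := fun P _ =>
    Integrable.of_bound hc.measurable.aestronglyMeasurable M (ae_of_all _ hM)
  have hN : 0 < N := by
    rcases Nat.eq_zero_or_pos N with rfl | h
    · simp at hlt
    · exact h
  obtain ⟨ε, hε, hεN⟩ : ∃ ε : ℝ, 0 < ε ∧
      ∑ i, c ((z (σ i)).1, (z i).2) + N * (2 * ε) < ∑ i, c (z i) := by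
    have hN' : (0 : ℝ) < N := by exact_mod_cast hN
    -- With this `ε` the errors, `ε` per point before and after rearranging, use up only half of the
    -- gap.
    refine ⟨(∑ i, c (z i) - ∑ i, c ((z (σ i)).1, (z i).2)) / (4 * N),
      div_pos (sub_pos.2 hlt) (by positivity), ?_⟩
    field_simp
    linarith
  obtain ⟨U, V, hU, hV, hUV⟩ := exists_open_rectangles hc z hε
  have hWm : ∀ i, MeasurableSet (U i ×ˢ V i) := fun i =>
    (hU i).1.measurableSet.prod (hV i).1.measurableSet
  have hpos : ∀ i, γ (U i ×ˢ V i) ≠ 0 := fun i =>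
    ((Measure.mem_support_iff_forall _).1 (hz i) _
      (((hU i).1.prod (hV i).1).mem_nhds ⟨(hU i).2, (hV i).2⟩)).ne'
  obtain ⟨s, hs₀, hs, hsle⟩ := exists_sum_smul_cond_le γ hN hWm hpos
  have hη : ∀ i, IsProbabilityMeasure γ[|U i ×ˢ V i] := fun i =>
    ProbabilityTheory.cond_isProbabilityMeasure (hpos i)
  have hηW : ∀ i, ∀ᵐ w ∂γ[|U i ×ˢ V i], w.1 ∈ U i ∧ w.2 ∈ V i := fun i =>
    ProbabilityTheory.ae_cond_mem (hWm i)
  set η : Fin N → Measure (X × Y) := fun i => γ[|U i ×ˢ V i] with hη_def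
  have hfst : ∀ i, IsProbabilityMeasure ((η i).map Prod.fst) := fun i =>
    Measure.isProbabilityMeasure_map measurable_fst.aemeasurable
  have hsnd : ∀ i, IsProbabilityMeasure ((η i).map Prod.snd) := fun i =>
    Measure.isProbabilityMeasure_map measurable_snd.aemeasurable
  -- Mass near `z i` is removed and recoupled: first marginals are permuted by `σ`, second ones
  -- kept, so the total marginals do not change.
  set π : Fin N → Measure (X × Y) := fun i => ((η (σ i)).map Prod.fst).prod ((η i).map Prod.snd)
    with hπ_def
  have hρfin : IsFiniteMeasure (∑ i, s • η i) := isFiniteMeasure_of_le γ hsle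
  have hfin : ∀ P : Measure (X × Y), IsProbabilityMeasure P → IsFiniteMeasure (s • P) :=
    fun P _ => Measure.smul_finite P hs
  have hτfin : IsFiniteMeasure (γ - ∑ i, s • η i) := isFiniteMeasure_of_le γ Measure.sub_le
  have hγ : γ - ∑ i, s • η i + ∑ i, s • η i = γ := Measure.sub_add_cancel_of_le hsle
  have hmap₁ : (γ - ∑ i, s • η i + ∑ i, s • π i).map Prod.fst = γ.map Prod.fst := by
    conv_rhs => rw [← hγ]
    rw [Measure.map_add _ _ measurable_fst, Measure.map_add _ _ measurable_fst,
      map_sum_smul measurable_fst, map_sum_smul measurable_fst]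
    congr 1
    simp only [hπ_def, Measure.map_fst_prod, measure_univ, one_smul]
    exact Equiv.sum_comp σ fun i => s • (η i).map Prod.fst
  have hmap₂ : (γ - ∑ i, s • η i + ∑ i, s • π i).map Prod.snd = γ.map Prod.snd := by
    conv_rhs => rw [← hγ]
    rw [Measure.map_add _ _ measurable_snd, Measure.map_add _ _ measurable_snd,
      map_sum_smul measurable_snd, map_sum_smul measurable_snd]
    congr 1
    simp only [hπ_def, Measure.map_snd_prod, measure_univ, one_smul]
  have hprob : IsProbabilityMeasure (γ - ∑ i, s • η i + ∑ i, s • π i) := by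
    refine ⟨?_⟩
    have h := congrArg (fun P => P Set.univ) hmap₁
    simpa [Measure.map_apply measurable_fst MeasurableSet.univ] using h
  have hπfin : IsFiniteMeasure (∑ i, s • π i) :=
    isFiniteMeasure_of_le (γ - ∑ i, s • η i + ∑ i, s • π i) (Measure.le_add_left le_rfl)
  have hsum : ∀ P : Fin N → Measure (X × Y), (∀ i, IsProbabilityMeasure (P i)) →
      ∫ w, c w ∂(∑ i, s • P i) = s.toReal * ∑ i, ∫ w, c w ∂(P i) := fun P hP => by
    rw [integral_finsetSum_measure fun i _ => hint _ (hfin (P i) (hP i))]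
    simp only [integral_smul_measure, smul_eq_mul, Finset.mul_sum]
  have hle := hopt _ hprob hmap₁ hmap₂
  conv_lhs at hle => rw [← hγ]
  rw [integral_add_measure (hint _ hτfin) (hint _ hρfin),
    integral_add_measure (hint _ hτfin) (hint _ hπfin), hsum η hη,
    hsum π fun i => inferInstance, add_le_add_iff_left,
    mul_le_mul_iff_right₀ (ENNReal.toReal_pos hs₀ hs)] at hle
  have h₁ : ∀ i, c (z i) - ε ≤ ∫ w, c w ∂(η i) := fun i => by
    have := abs_integral_sub_le_of_ae (hint (η i) inferInstance) (a := c (z i)) (ε := ε)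
      ((hηW i).mono fun w hw => hUV i i w.1 hw.1 w.2 hw.2)
    linarith [(abs_le.1 this).1]
  have h₂ : ∀ i, ∫ w, c w ∂(π i) ≤ c ((z (σ i)).1, (z i).2) + ε := fun i => by
    have := abs_integral_sub_le_of_ae (hint (π i) inferInstance)
      (a := c ((z (σ i)).1, (z i).2)) (ε := ε)
      ((ae_mem_fst_prod_snd (hU (σ i)).1.measurableSet (hV i).1.measurableSet
        ((hηW (σ i)).mono fun w hw => hw.1) ((hηW i).mono fun w hw => hw.2)).mono
        fun w hw => hUV (σ i) i w.1 hw.1 w.2 hw.2)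
    linarith [(abs_le.1 this).2]
  have h₃ := Finset.sum_le_sum fun i (_ : i ∈ Finset.univ) => h₁ i
  have h₄ := Finset.sum_le_sum fun i (_ : i ∈ Finset.univ) => h₂ i
  simp only [Finset.sum_sub_distrib, Finset.sum_add_distrib, Finset.sum_const, Finset.card_univ,
    Fintype.card_fin, nsmul_eq_mul] at h₃ h₄
  linarith

/-- The Kantorovich problem with a bounded continuous cost on Polish spaces has a solution. -/
theorem exists_optimal_plan {c : X × Y → ℝ} (hc : Continuous c) {M : ℝ} (hM : ∀ z, |c z| ≤ M)
    (μ : Measure X) (ν : Measure Y) [IsProbabilityMeasure μ] [IsProbabilityMeasure ν] :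
    ∃ γ : Measure (X × Y), IsProbabilityMeasure γ ∧ γ.map Prod.fst = μ ∧ γ.map Prod.snd = ν ∧
      ∀ γ' : Measure (X × Y), IsProbabilityMeasure γ' → γ'.map Prod.fst = μ →
        γ'.map Prod.snd = ν → ∫ z, c z ∂γ ≤ ∫ z, c z ∂γ' := by
  let := TopologicalSpace.upgradeIsCompletelyMetrizable X
  let := TopologicalSpace.upgradeIsCompletelyMetrizable Y
  let S : Set (ProbabilityMeasure (X × Y)) :=
    {γ | γ.map measurable_fst.aemeasurable = (⟨μ, ‹_›⟩ : ProbabilityMeasure X) ∧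
      γ.map measurable_snd.aemeasurable = (⟨ν, ‹_›⟩ : ProbabilityMeasure Y)}
  have hmem : ∀ γ : ProbabilityMeasure (X × Y), γ ∈ S ↔
      (γ : Measure (X × Y)).map Prod.fst = μ ∧ (γ : Measure (X × Y)).map Prod.snd = ν :=
    fun γ => and_congr Subtype.ext_iff Subtype.ext_iff
  have hclosed : IsClosed S :=
    (isClosed_eq (ProbabilityMeasure.continuous_map continuous_fst) continuous_const).inter
      (isClosed_eq (ProbabilityMeasure.continuous_map continuous_snd) continuous_const)
  have htight : IsTightMeasureSet
      {((γ : ProbabilityMeasure (X × Y)) : Measure (X × Y)) | γ ∈ S} := by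
    -- Each marginal family lies in a singleton, and a single probability measure on a Polish space
    -- is tight.
    refine IsTightMeasureSet.prodMk
      ((isTightMeasureSet_singleton (μ := μ)).subset ?_)
      ((isTightMeasureSet_singleton (μ := ν)).subset ?_)
    · rintro _ ⟨_, ⟨γ, hγ, rfl⟩, rfl⟩
      exact ((hmem γ).1 hγ).1
    · rintro _ ⟨_, ⟨γ, hγ, rfl⟩, rfl⟩
      exact ((hmem γ).1 hγ).2
  have hcompact : IsCompact S := by
    rw [← hclosed.closure_eq]
    exact isCompact_closure_of_isTightMeasureSet htight
  have hne : S.Nonempty :=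
    ⟨⟨μ.prod ν, inferInstance⟩, (hmem _).2 ⟨by simp [Measure.map_fst_prod],
      by simp [Measure.map_snd_prod]⟩⟩
  let cb : (X × Y) →ᵇ ℝ := BoundedContinuousFunction.ofNormedAddCommGroup c hc M hM
  obtain ⟨γ, hγ, hmin⟩ := hcompact.exists_isMinOn hne
    (ProbabilityMeasure.continuous_integral_boundedContinuousFunction cb).continuousOn
  refine ⟨γ, inferInstance, ((hmem γ).1 hγ).1, ((hmem γ).1 hγ).2, fun γ' hγ' h₁ h₂ => ?_⟩
  exact hmin (show (⟨γ', hγ'⟩ : ProbabilityMeasure (X × Y)) ∈ S from (hmem _).2 ⟨h₁, h₂⟩)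

/-- An optimal plan for a bounded continuous cost, with a potential that is tight on it. -/
theorem exists_optimal_plan_potential {c : X × Y → ℝ} (hc : Continuous c) {M : ℝ}
    (hM : ∀ z, |c z| ≤ M) (μ : Measure X) (ν : Measure Y) [IsProbabilityMeasure μ]
    [IsProbabilityMeasure ν] :
    ∃ γ : Measure (X × Y), IsProbabilityMeasure γ ∧ γ.map Prod.fst = μ ∧ γ.map Prod.snd = ν ∧
      (∀ γ' : Measure (X × Y), IsProbabilityMeasure γ' → γ'.map Prod.fst = μ →
        γ'.map Prod.snd = ν → ∫ z, c z ∂γ ≤ ∫ z, c z ∂γ') ∧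
      ∃ φ : X → ℝ, (∀ x x', φ x - φ x' ≤ dUpper c x x') ∧ (∃ B, ∀ x, |φ x| ≤ B) ∧
        ∀ᵐ z ∂γ, ∀ x, φ x - φ z.1 ≤ c (x, z.2) - c z := by
  obtain ⟨γ, hγ, h₁, h₂, hopt⟩ := exists_optimal_plan hc hM μ ν
  have hcyc : IsCyclicallyMonotone c γ.support :=
    isCyclicallyMonotone_support hc hM γ fun γ' hγ' h₁' h₂' =>
      hopt γ' hγ' (h₁'.trans h₁) (h₂'.trans h₂)
  obtain ⟨φ, hφ, hB, hΓ⟩ := hcyc.exists_potential hM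
    (Measure.nonempty_support (IsProbabilityMeasure.ne_zero γ))
  exact ⟨γ, hγ, h₁, h₂, hopt, φ, hφ, hB, Filter.mem_of_superset Measure.support_mem_ae hΓ⟩

end OptimalPlans

/-! ### Approximation by grid corners in the Sorgenfrey topology. -/

section Sorgenfrey

variable {n : ℕ}

/-- The upper right corner of the cell containing `x` of the cubic grid of mesh `1 / (k + 1)`. -/
noncomputable def gridCorner (k : ℕ) (x : Fin n → ℝ) : Fin n → ℝ :=
  fun i => (⌊((k : ℝ) + 1) * x i⌋ + 1) / ((k : ℝ) + 1)

lemma lt_gridCorner (k : ℕ) (x : Fin n → ℝ) (i : Fin n) : x i < gridCorner k x i := by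
  have hk : (0 : ℝ) < k + 1 := by positivity
  rw [gridCorner, lt_div_iff₀ hk, mul_comm]
  exact Int.lt_floor_add_one _

lemma gridCorner_le (k : ℕ) (x : Fin n → ℝ) (i : Fin n) :
    gridCorner k x i ≤ x i + 1 / ((k : ℝ) + 1) := by
  have hk : (0 : ℝ) < k + 1 := by positivity
  rw [gridCorner, add_div]
  gcongr
  rw [div_le_iff₀ hk, mul_comm]
  exact Int.floor_le _

/-- The corners approach `x` strictly from the upper right, so they eventually stay in any half-open
rectangle containing `x`. -/
lemma tendsto_gridCorner (x : Fin n → ℝ) :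
    Tendsto (fun k => toSorgenfrey n (gridCorner k x)) atTop (𝓝 (toSorgenfrey n x)) := by
  refine TopologicalSpace.tendsto_nhds_generateFrom_iff.2 ?_
  rintro _ ⟨a, b, -, rfl⟩ hx
  have hx' : ∀ i, a i ≤ x i ∧ x i < b i := hx
  have h : ∀ i, ∀ᶠ k : ℕ in atTop, gridCorner k x i < b i := fun i => by
    have ht : Tendsto (fun k : ℕ => x i + 1 / ((k : ℝ) + 1)) atTop (𝓝 (x i)) := by
      simpa using tendsto_one_div_add_atTop_nhds_zero_nat.const_add (x i)
    filter_upwards [ht.eventually_lt_const (hx' i).2] with k hk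
    exact (gridCorner_le k x i).trans_lt hk
  filter_upwards [eventually_all.2 h] with k hk i
  exact ⟨(hx' i).1.trans (lt_gridCorner k x i).le, hk i⟩

lemma measurable_gridIndex (k : ℕ) :
    Measurable fun (x : Fin n → ℝ) (i : Fin n) => ⌊((k : ℝ) + 1) * x i⌋ :=
  measurable_pi_lambda _ fun i => ((measurable_pi_apply i).const_mul _).floor

lemma countable_range_gridCorner (n : ℕ) :
    (⋃ k, Set.range (gridCorner (n := n) k)).Countable := by
  refine Set.countable_iUnion fun k => (Set.countable_range
    (fun m : Fin n → ℤ => fun i => ((m i : ℝ) + 1) / ((k : ℝ) + 1))).mono ?_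
  rintro _ ⟨x, rfl⟩
  exact ⟨_, rfl⟩

/-- Functions on `ℝⁿ` that are continuous in the Sorgenfrey topology are Borel measurable. -/
lemma measurable_comp_toSorgenfrey {f : SorgenfreySpace n → ℝ} (hf : Continuous f) :
    Measurable fun x => f (toSorgenfrey n x) := by
  refine measurable_of_tendsto_metrizable
    (f := fun k x => f (toSorgenfrey n (gridCorner k x))) (fun k => ?_)
    (tendsto_pi_nhds.2 fun x => (hf.tendsto _).comp (tendsto_gridCorner x))
  -- The approximants factor through the discrete countable space of grid indices, so no regularity
  -- of `f` is needed for them.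
  exact (Measurable.of_discrete (f := fun m : Fin n → ℤ => f (toSorgenfrey n
    fun i => ((m i : ℝ) + 1) / ((k : ℝ) + 1)))).comp (measurable_gridIndex k)

end Sorgenfrey

/-! ### Refining a Polish topology. -/

section Refinement

/-- A Borel measurable separable family of distances becomes continuous in a finer Polish
topology with the same Borel sets. -/
lemma exists_finer_polish {X : Type*} [t : TopologicalSpace X] [PolishSpace X] [MeasurableSpace X]
    [BorelSpace X] {d : X → X → ℝ} (hcomm : ∀ x x', d x x' = d x' x)
    (htri : ∀ x y z, d x z ≤ d x y + d y z) (hnonneg : ∀ x x', 0 ≤ d x x') {D : Set X}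
    (hD : D.Countable)
    (hdense : ∀ x, ∀ ε > 0, ∃ q ∈ D, d x q < ε) (hmeas : ∀ q, Measurable fun x => d x q) :
    ∃ t' : TopologicalSpace X, @PolishSpace X t' ∧ @BorelSpace X t' _ ∧
      ∀ x₀, Tendsto (fun x => d x x₀) (@nhds X t' x₀) (𝓝 0) := by
  have : Countable D := hD.to_subtype
  obtain ⟨t', hle, hcont, hpol⟩ := Measurable.exists_continuous
    (f := fun (x : X) (q : D) => d x q) (measurable_pi_lambda _ fun q => hmeas q)
  refine ⟨t', hpol, ?_, fun x₀ => ?_⟩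
  · refine @BorelSpace.mk X t' _ ?_
    -- Comparable Polish topologies have the same Borel sets.
    exact (@BorelSpace.measurable_eq X t _ _).trans (borel_eq_borel_of_le hpol ‹_› hle).symm
  · let := t'
    refine tendsto_order.2 ⟨fun a ha => Eventually.of_forall fun x => ha.trans_le (hnonneg _ _),
      fun ε hε => ?_⟩
    -- Only distances to points of `D` were made continuous; density and the triangle inequality
    -- handle an arbitrary `x₀`.
    obtain ⟨q, hq, hxq⟩ := hdense x₀ (ε / 2) (half_pos hε)
    have hq' : Continuous fun x => d x q := (continuous_apply (⟨q, hq⟩ : D)).comp hcont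
    filter_upwards [hq'.continuousAt.eventually_lt_const hxq] with x hx
    have h := htri x q x₀
    rw [hcomm q x₀] at h
    linarith

end Refinement

/-! ### Consequences of property (H). -/

section SorgenfreyCost

variable {n : ℕ} {Y : Type*} {M : ℝ}

lemma continuous_of_sub_le_dUpper {X : Type*} [TopologicalSpace X] {c : X × Y → ℝ}
    (h : ∀ x₀, Tendsto (fun x => dUpper c x x₀) (𝓝 x₀) (𝓝 0)) {φ : X → ℝ}
    (hφ : ∀ x x', φ x - φ x' ≤ dUpper c x x') : Continuous φ := by
  refine continuous_iff_continuousAt.2 fun x₀ => tendsto_iff_dist_tendsto_zero.2 ?_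
  refine squeeze_zero (fun _ => dist_nonneg) (fun x => ?_) (h x₀)
  rw [Real.dist_eq, abs_le]
  have h₁ := hφ x x₀
  have h₂ := hφ x₀ x
  rw [dUpper_comm] at h₂
  exact ⟨by linarith, h₁⟩

lemma continuous_of_propertyH {X : Type*} [TopologicalSpace X] [TopologicalSpace Y]
    {c : X × Y → ℝ} (hM : ∀ z, |c z| ≤ M) (hH : PropertyH c) : Continuous c := by
  refine continuous_iff_continuousAt.2 fun ⟨x₀, y₀⟩ => tendsto_iff_dist_tendsto_zero.2 ?_
  have h := ((hH.1 x₀).comp (tendsto_fst (g := 𝓝 y₀))).add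
    ((hH.2 y₀).comp (tendsto_snd (f := 𝓝 x₀)))
  rw [add_zero, ← nhds_prod_eq] at h
  refine squeeze_zero (fun _ => dist_nonneg) (fun z => ?_) h
  have h₁ := abs_sub_le_dUpper hM z.1 x₀ z.2
  have h₂ := abs_sub_le_dLower hM x₀ z.2 y₀
  exact (abs_sub_le _ (c (x₀, z.2)) _).trans (add_le_add h₁ h₂)

/-- A bounded cost that is continuous in its Sorgenfrey variable, uniformly in the other, is so
for a Polish topology with the same Borel sets as `ℝⁿ`. -/
lemma exists_polish_of_sorgenfrey {c : SorgenfreySpace n × Y → ℝ} (hM : ∀ z, |c z| ≤ M)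
    (h : ∀ x₀, Tendsto (fun x => dUpper c x x₀) (𝓝 x₀) (𝓝 0)) :
    ∃ t' : TopologicalSpace (Fin n → ℝ), @PolishSpace _ t' ∧ @BorelSpace _ t' _ ∧
      ∀ x₀, Tendsto (fun x => dUpper c (toSorgenfrey n x) (toSorgenfrey n x₀)) (@nhds _ t' x₀)
        (𝓝 0) := by
  refine exists_finer_polish (fun _ _ => dUpper_comm c _ _) (fun _ _ _ => dUpper_triangle hM _ _ _)
    (fun _ _ => dUpper_nonneg c _ _) (countable_range_gridCorner n) (fun x ε hε => ?_)
    fun q => measurable_comp_toSorgenfrey (f := fun x => dUpper c x (toSorgenfrey n q))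
      (continuous_of_sub_le_dUpper h fun x x' => ?_)
  · obtain ⟨k, hk⟩ := (((h (toSorgenfrey n x)).comp
      (tendsto_gridCorner x)).eventually_lt_const hε).exists
    refine ⟨gridCorner k x, Set.mem_iUnion.2 ⟨k, x, rfl⟩, ?_⟩
    rw [dUpper_comm]
    exact hk
  · have := dUpper_triangle hM x x' (toSorgenfrey n q)
    linarith

end SorgenfreyCost

/-! ### Transfer to the Sorgenfrey cost, and duality. -/

section Duality

variable {n p : ℕ}

/-- An optimal plan for a cost with property (H), with a potential that is tight on it. -/
lemma exists_plan_potential_of_propertyH (μ : Measure (Fin n → ℝ)) [IsProbabilityMeasure μ]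
    (ν : Measure (Fin p → ℝ)) [IsProbabilityMeasure ν]
    {c : SorgenfreySpace n × SorgenfreySpace p → ℝ} {M : ℝ} (hM : ∀ z, |c z| ≤ M)
    (hH : PropertyH c) :
    Measurable (costOnEuclidean c) ∧
    ∃ γ ∈ transportPlans μ ν, (∀ γ' ∈ transportPlans μ ν,
        primalObjective c γ ≤ primalObjective c γ') ∧
      ∃ ξ : SorgenfreySpace n →ᵇ ℝ, ∀ᵐ z ∂γ, ∀ x,
        ξ x - ξ (toSorgenfrey n z.1) ≤ c (x, toSorgenfrey p z.2) - costOnEuclidean c z := by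
  obtain ⟨t₁, hpol₁, hbor₁, ht₁⟩ := exists_polish_of_sorgenfrey hM hH.1
  obtain ⟨t₂, hpol₂, hbor₂, ht₂⟩ :=
    exists_polish_of_sorgenfrey (c := c ∘ Prod.swap) (fun _ => hM _) hH.2
  have hcont : @Continuous _ _ (@instTopologicalSpaceProd _ _ t₁ t₂) _ (costOnEuclidean c) :=
    @continuous_of_propertyH _ M _ t₁ t₂ (costOnEuclidean c) (fun _ => hM _) ⟨ht₁, ht₂⟩
  refine ⟨?_, ?_⟩
  · let := t₁
    let := t₂
    exact hcont.measurable
  obtain ⟨γ, hγ, h₁, h₂, hopt, φ, hφ, ⟨B, hB⟩, hae⟩ :=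
    @exists_optimal_plan_potential _ _ t₁ t₂ hpol₁ hpol₂ _ _ hbor₁ hbor₂ _ hcont M
      (fun _ => hM _) μ ν _ _
  -- The Radon property is automatic for a finite Borel measure on this Euclidean product.
  refine ⟨γ, ⟨hγ, inferInstance, h₁, h₂⟩, fun γ' h => hopt γ' h.1 h.2.2.1 h.2.2.2,
    BoundedContinuousFunction.ofNormedAddCommGroup (fun x => φ ((toSorgenfrey n).symm x))
      (continuous_of_sub_le_dUpper hH.1 fun x x' => hφ x x') B fun x => hB _, ?_⟩
  filter_upwards [hae] with z hz x
  exact hz ((toSorgenfrey n).symm x)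

lemma integrable_comp_toSorgenfrey (μ : Measure (Fin n → ℝ)) [IsFiniteMeasure μ]
    (φ : SorgenfreySpace n →ᵇ ℝ) : Integrable (fun x => φ (toSorgenfrey n x)) μ :=
  Integrable.of_bound (measurable_comp_toSorgenfrey φ.continuous).aestronglyMeasurable ‖φ‖
    (ae_of_all _ fun _ => φ.norm_coe_le_norm _)

/-- The dual objective as an integral against a transport plan. -/
lemma dualObjective_eq_integral {μ : Measure (Fin n → ℝ)} {ν : Measure (Fin p → ℝ)}
    {γ : Measure ((Fin n → ℝ) × (Fin p → ℝ))} (hγ : γ ∈ transportPlans μ ν)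
    (q : (SorgenfreySpace n →ᵇ ℝ) × (SorgenfreySpace p →ᵇ ℝ)) :
    Integrable (fun z : (Fin n → ℝ) × (Fin p → ℝ) =>
        q.1 (toSorgenfrey n z.1) + q.2 (toSorgenfrey p z.2)) γ ∧
      dualObjective μ ν q = ∫ z, (q.1 (toSorgenfrey n z.1) + q.2 (toSorgenfrey p z.2)) ∂γ := by
  obtain ⟨hprob, -, rfl, rfl⟩ := hγ
  have h₁ := integrable_comp_toSorgenfrey (γ.map Prod.fst) q.1
  have h₂ := integrable_comp_toSorgenfrey (γ.map Prod.snd) q.2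
  have h₁' := h₁.comp_measurable measurable_fst
  have h₂' := h₂.comp_measurable measurable_snd
  refine ⟨h₁'.add h₂', ?_⟩
  rw [dualObjective, integral_map measurable_fst.aemeasurable h₁.aestronglyMeasurable,
    integral_map measurable_snd.aemeasurable h₂.aestronglyMeasurable]
  exact (integral_add h₁' h₂').symm

end Duality

theorem mainTheorem9 (n p : ℕ)
    (μ : Measure (Fin n → ℝ)) [IsProbabilityMeasure μ] [μ.InnerRegular]
    (ν : Measure (Fin p → ℝ)) [IsProbabilityMeasure ν] [ν.InnerRegular]
    (c : SorgenfreySpace n × SorgenfreySpace p → ℝ)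
    (hbdd : ∃ M : ℝ, ∀ z, |c z| ≤ M) (hH : PropertyH c) :
    -- all the integrals involved are well defined
    (∀ γ ∈ transportPlans μ ν, Integrable (costOnEuclidean c) γ) ∧
    (∀ φ : SorgenfreySpace n →ᵇ ℝ, Integrable (fun x => φ (toSorgenfrey n x)) μ) ∧
    (∀ ψ : SorgenfreySpace p →ᵇ ℝ, Integrable (fun y => ψ (toSorgenfrey p y)) ν) ∧
    -- (KP) has a solution
    (∃ γ ∈ transportPlans μ ν, IsMinOn (primalObjective c) (transportPlans μ ν) γ) ∧
    -- (DP) has a solution given by a pair of transforms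
    (∃ (ξ φ : SorgenfreySpace n →ᵇ ℝ) (ψ : SorgenfreySpace p →ᵇ ℝ),
      (φ : SorgenfreySpace n → ℝ) = cBarTransform c (cTransform c ξ) ∧
      (ψ : SorgenfreySpace p → ℝ) = cTransform c ξ ∧
      (φ, ψ) ∈ dualAdmissible c ∧
      IsMaxOn (dualObjective μ ν) (dualAdmissible c) (φ, ψ)) ∧
    -- duality
    dualValue c μ ν = primalValue c μ ν := by
  obtain ⟨M, hM⟩ := hbdd
  obtain ⟨hcm, γ, hγ, hopt, ξ, hξ⟩ := exists_plan_potential_of_propertyH μ ν hM hH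
  have hint : ∀ γ ∈ transportPlans μ ν, Integrable (costOnEuclidean c) γ := fun γ hγ => by
    have := hγ.1
    exact Integrable.of_bound hcm.aestronglyMeasurable M (ae_of_all _ fun _ => hM _)
  have hweak : ∀ q ∈ dualAdmissible c, ∀ γ ∈ transportPlans μ ν,
      dualObjective μ ν q ≤ primalObjective c γ := fun q hq γ hγ => by
    obtain ⟨hi, he⟩ := dualObjective_eq_integral hγ q
    rw [he]
    exact integral_mono hi (hint γ hγ) fun z => hq _ _
  have hX : Nonempty (SorgenfreySpace n) := ⟨toSorgenfrey n 0⟩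
  have hY : Nonempty (SorgenfreySpace p) := ⟨toSorgenfrey p 0⟩
  have hB : ∀ x, |ξ x| ≤ ‖ξ‖ := ξ.norm_coe_le_norm
  have hB' := abs_cTransform_le hM hB
  have hM' : ∀ z, |(c ∘ Prod.swap) z| ≤ M := fun _ => hM _
  let ψ : SorgenfreySpace p →ᵇ ℝ := BoundedContinuousFunction.ofNormedAddCommGroup
    (cTransform c ξ) (continuous_of_sub_le_dUpper (c := c ∘ Prod.swap) hH.2
      fun y y' => cTransform_sub_le hM hB y y') _ hB'
  let φ : SorgenfreySpace n →ᵇ ℝ := BoundedContinuousFunction.ofNormedAddCommGroup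
    (cBarTransform c (cTransform c ξ)) (continuous_of_sub_le_dUpper hH.1
      fun x x' => cTransform_sub_le (c := c ∘ Prod.swap) hM' hB' x x') _
      (abs_cTransform_le (c := c ∘ Prod.swap) hM' hB')
  have hadm : (φ, ψ) ∈ dualAdmissible c := fun x y => by
    have := add_cTransform_le (c := c ∘ Prod.swap) hM' hB' y x
    exact (add_comm _ _).trans_le this
  have hξφ : ∀ x, ξ x ≤ φ x := fun x => le_ciInf fun y => by
    have := add_cTransform_le hM hB x y
    linarith
  have heq : dualObjective μ ν (φ, ψ) = primalObjective c γ := by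
    rw [(dualObjective_eq_integral hγ (φ, ψ)).2]
    refine integral_congr_ae ?_
    filter_upwards [hξ] with z hz
    -- Tightness of `ξ` bounds `ψ` below by `c - ξ`, and `ξ ≤ φ` does the rest.
    refine le_antisymm (hadm _ _) ?_
    have h₁ : costOnEuclidean c z - ξ (toSorgenfrey n z.1) ≤ ψ (toSorgenfrey p z.2) :=
      le_ciInf fun x => by
        have := hz x
        linarith
    have h₂ := hξφ (toSorgenfrey n z.1)
    change c _ ≤ φ _ + ψ _
    change c _ - _ ≤ _ at h₁
    exact (sub_le_iff_le_add'.1 h₁).trans (add_le_add_left h₂ _)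
  have hmax : IsMaxOn (dualObjective μ ν) (dualAdmissible c) (φ, ψ) := fun q hq =>
    (hweak q hq γ hγ).trans_eq heq.symm
  refine ⟨hint, integrable_comp_toSorgenfrey μ, integrable_comp_toSorgenfrey ν,
    ⟨γ, hγ, fun γ' hγ' => hopt γ' hγ'⟩, ⟨ξ, φ, ψ, rfl, rfl, hadm, hmax⟩, ?_⟩
  have h₁ : IsGreatest (dualObjective μ ν '' dualAdmissible c) (dualObjective μ ν (φ, ψ)) :=
    ⟨⟨_, hadm, rfl⟩, by rintro _ ⟨q, hq, rfl⟩; exact hmax hq⟩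
  have h₂ : IsLeast (primalObjective c '' transportPlans μ ν) (primalObjective c γ) :=
    ⟨⟨γ, hγ, rfl⟩, by rintro _ ⟨γ', hγ', rfl⟩; exact hopt γ' hγ'⟩
  rw [dualValue, primalValue, h₁.csSup_eq, h₂.csInf_eq, heq]
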